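/- Let $a<b$ be real numbers and let $f:[a,b]\to\mathbb{R}$ be decreasing and continuously differentiable with $0<\inf_{[a,b]}|f'|\le\sup_{[a,b]}|f'|<\infty$; put $F(t)=\int_a^t f(x)\,dx$ for $t\in[a,b]$. Let $L:[a,b]\to\mathbb{R}$ be increasing and continuously differentiable with $0<\inf_{[a,b]}L'\le\sup_{[a,b]}L'<\infty$, and write $I=[L(a),L(b)]$. For each $n$ let, on a probability space $(\Omega_n,\mathbb{P}_n)$ which may depend on $n$, $F_n$ be a process on $[a,b]$ with càdlàg paths, let $\hat F_n$ be its least concave majorant on $[a,b]$, and let $B_n$ be a process with continuous paths on $I$. Assume that either every $B_n$ is a Brownian motion on $I$ (independent increments, $B_n(t)-B_n(s)\sim N(0,t-s)$ for $s\le t$ in $I$, and $B_n(0)=0$ almost surely in case $0\in I$), or every $B_n$ is the restriction to $I$ of a Brownian bridge on a fixed interval $[p,q]\supseteq I$ (a centred Gaussian process with covariance $(s-p)(q-t)/(q-p)$ for $s\le t$; the standard Brownian bridge is the case $p=0$, $q=1$). Assume moreover that $$\sup_{t\in[a,b]}\left|F_n(t)-F(t)-n^{-1/2}B_n(L(t))\right|=O_p(\gamma_n)\quad\text{for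 some sequence}\quad \gamma_n=O\left(\left(\frac{\log n}{n}\right)^{2/3}\right).$$ Then: 1. $\displaystyle \sup_{x\in[a,b]}|\hat F_n(x)-F_n(x)|=O_p\left(\left(\frac{\log n}{n}\right)^{2/3}\right).$ 2. If, in addition, $0\in[L(a),L(b)]$ and, for some $r\ge1$, $$\mathbb{E}\left[\sup_{t\in[a,b]}\left|F_n(t)-F(t)-n^{-1/2}B_n(L(t))\right|^r\right]=O\left(\left(\frac{\log n}{n}\right)^{2r/3}\right),$$ then $$\mathbb{E}\left[\sup_{x\in[a,b]}|\hat F_n(x)-F_n(x)|^r\right]=O\left(\left(\frac{\log n}{n}\right)^{2r/3}\right).$$ 3. There are $K_1,K_2>0$ such that for all $n$, all $x\in I$, all $u\in(0,1]$ and all $v>0$, $$\mathbb{P}_n\left(\sup_{y\in I,\,|x-y|\le u}|B_n(x)-B_n(y)|>v\right)\le K_1\exp(-K_2v^2u^{-1}),$$ $$\mathbb{P}_n\left(\sup_{z\ge u,\,x-z\in I}\left\{B_n(x-z)-B_n(x)-vz^2\right\}>0\right)\le K_1\exp(-K_2v^2u^{3}).$$ -/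

import Mathlib

open MeasureTheory ProbabilityTheory Filter Topology Set
open scoped ENNReal NNReal

noncomputable section

/-- `f` is decreasing and continuously differentiable on `[a,b]`, and `|f'|` is bounded and bounded
away from zero there (one-sided derivatives at the end points). -/
structure IsRegularDecreasing (f : ℝ → ℝ) (a b : ℝ) : Prop where
  antitoneOn : AntitoneOn f (Icc a b)
  contDiffOn : ContDiffOn ℝ 1 f (Icc a b)
  bounds : ∃ c C : ℝ, 0 < c ∧ ∀ t ∈ Icc a b,
    c ≤ |derivWithin f (Icc a b) t| ∧ |derivWithin f (Icc a b) t| ≤ C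

/-- `L` is increasing and continuously differentiable on `[a,b]`, and `L'` is bounded and bounded
away from zero there (one-sided derivatives at the end points). -/
structure IsRegularIncreasing (L : ℝ → ℝ) (a b : ℝ) : Prop where
  monotoneOn : MonotoneOn L (Icc a b)
  contDiffOn : ContDiffOn ℝ 1 L (Icc a b)
  bounds : ∃ c C : ℝ, 0 < c ∧ ∀ t ∈ Icc a b,
    c ≤ derivWithin L (Icc a b) t ∧ derivWithin L (Icc a b) t ≤ C

/-- `g` is right-continuous with left limits on `[a,b]`. -/
structure IsCadlagOn (g : ℝ → ℝ) (a b : ℝ) : Prop where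
  right_cont : ∀ t ∈ Ico a b, ContinuousWithinAt g (Ici t) t
  left_lim : ∀ t ∈ Ioc a b, ∃ l : ℝ, Tendsto g (𝓝[<] t) (𝓝 l)

/-- The least concave majorant of `g` on `S`: the pointwise infimum of all concave functions on `S`
that lie above `g`. -/
def leastConcaveMajorant (S : Set ℝ) (g : ℝ → ℝ) (x : ℝ) : ℝ :=
  sInf {y : ℝ | ∃ h : ℝ → ℝ, ConcaveOn ℝ S h ∧ (∀ t ∈ S, g t ≤ h t) ∧ h x = y}

/-- `sup_{x ∈ S} |g x|`, as an extended nonnegative number. -/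
def supAbs (S : Set ℝ) (g : ℝ → ℝ) : ℝ≥0∞ :=
  ⨆ x ∈ S, ‖g x‖ₑ

/-- `X_n = O_p(ρ_n)` for nonnegative random variables `X_n`, each on its own probability space. -/
def IsBigOInProb {Ω : ℕ → Type*} [∀ n, MeasurableSpace (Ω n)] (P : ∀ n, Measure (Ω n))
    (X : ∀ n, Ω n → ℝ≥0∞) (ρ : ℕ → ℝ) : Prop :=
  ∀ ε : ℝ≥0∞, 0 < ε → ∃ M : ℝ≥0, ∀ᶠ n in atTop,
    P n {ω | (M : ℝ≥0∞) * ENNReal.ofReal |ρ n| < X n ω} ≤ ε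

/-- `E[(X_n)^r] = O(ρ_n)` for nonnegative random variables `X_n`; in particular these moments are
finite for all large `n`. -/
def IsBigOMoment {Ω : ℕ → Type*} [∀ n, MeasurableSpace (Ω n)] (P : ∀ n, Measure (Ω n))
    (X : ∀ n, Ω n → ℝ≥0∞) (r : ℝ) (ρ : ℕ → ℝ) : Prop :=
  ∃ C : ℝ≥0, ∀ᶠ n in atTop, ∫⁻ ω, X n ω ^ r ∂(P n) ≤ (C : ℝ≥0∞) * ENNReal.ofReal |ρ n|

/-- `B` is a Brownian motion on the time set `I`: independent increments, `B_t - B_s ~ N(0, t - s)`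
for `s ≤ t` in `I`, almost surely continuous paths, and `B_0 = 0` almost surely if `0 ∈ I`.
On a time set that contains `0` and negative times this is two-sided Brownian motion;
if `0 ∉ I` the initial value is unrestricted. -/
structure IsBrownianMotionOn {Ω : Type*} [MeasurableSpace Ω] (I : Set ℝ) (B : ℝ → Ω → ℝ)
    (P : Measure Ω) : Prop where
  aemeasurable : ∀ t ∈ I, AEMeasurable (B t) P
  zero : 0 ∈ I → ∀ᵐ ω ∂P, B 0 ω = 0
  hasLaw_sub : ∀ s ∈ I, ∀ t ∈ I, s ≤ t →
    HasLaw (fun ω => B t ω - B s ω) (gaussianReal 0 (t - s).toNNReal) P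
  indep : HasIndepIncrements (fun t : I => B t) P
  cont : ∀ᵐ ω ∂P, ContinuousOn (fun t => B t ω) I

/-- `B` is the restriction to the time set `I ⊆ [p,q]` of a Brownian bridge from `(p,0)` to `(q,0)`:
a centred Gaussian process with covariance `(s - p) (q - t) / (q - p)` for `s ≤ t` and almost surely
continuous paths. The standard Brownian bridge is the case `p = 0`, `q = 1`. -/
structure IsBrownianBridgeOn {Ω : Type*} [MeasurableSpace Ω] (p q : ℝ) (I : Set ℝ)
    (B : ℝ → Ω → ℝ) (P : Measure Ω) : Prop where
  lt : p < q
  subset : I ⊆ Icc p q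
  gaussian : IsGaussianProcess (fun t : I => B t) P
  mean : ∀ t ∈ I, ∫ ω, B t ω ∂P = 0
  covariance : ∀ s ∈ I, ∀ t ∈ I, s ≤ t →
    ProbabilityTheory.covariance (B s) (B t) P = (s - p) * (q - t) / (q - p)
  cont : ∀ᵐ ω ∂P, ContinuousOn (fun t => B t ω) I

/-- Exponential tail bound for the local oscillations of a process on `I`:
`P(sup_{|x - y| ≤ u} |B x - B y| > v) ≤ K₁ exp(-K₂ v² u^{-τ})`. -/
def OscillationTailBound {Ω : Type*} [MeasurableSpace Ω] (τ K₁ K₂ : ℝ) (I : Set ℝ)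
    (B : ℝ → Ω → ℝ) (P : Measure Ω) : Prop :=
  ∀ x ∈ I, ∀ u ∈ Ioc (0 : ℝ) 1, ∀ v : ℝ, 0 < v →
    P {ω | ∃ y ∈ I, |x - y| ≤ u ∧ v < |B x ω - B y ω|} ≤
      ENNReal.ofReal (K₁ * Real.exp (-K₂ * v ^ 2 * u ^ (-τ)))

/-- Exponential tail bound for a process on `I` against a parabolic drift:
`P(sup_{z ≥ u} {B (x - z) - B x - v z²} > 0) ≤ K₁ exp(-K₂ v² u^{4 - τ})`. -/
def ParabolicTailBound {Ω : Type*} [MeasurableSpace Ω] (τ K₁ K₂ : ℝ) (I : Set ℝ)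
    (B : ℝ → Ω → ℝ) (P : Measure Ω) : Prop :=
  ∀ x ∈ I, ∀ u ∈ Ioc (0 : ℝ) 1, ∀ v : ℝ, 0 < v →
    P {ω | ∃ z : ℝ, u ≤ z ∧ x - z ∈ I ∧ 0 < B (x - z) ω - B x ω - v * z ^ 2} ≤
      ENNReal.ofReal (K₁ * Real.exp (-K₂ * v ^ 2 * u ^ (4 - τ)))

end

/-!
Both a Brownian motion and a Brownian bridge have centred Gaussian increments over `[s, t]` with
variance at most `t - s`; this and the continuity of the paths are all that is used about `B`
(`HasSubgaussianIncrements`). Dyadic chaining gives a Gaussian tail for the oscillation of `B` near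
a point,
`HasSubgaussianIncrements.measure_oscillation_le`, and peeling over dyadic ranges of `z` gives the
bound against a parabola, `HasSubgaussianIncrements.measure_parabolic_le`.

The rest is a comparison with tangent lines. Since `f' ≤ -c`, the primitive `F` lies below its
tangent at `x` by at least `(c / 2) (t - x) ^ 2`. If `F_n` is within `ε` of `F + W`, with
`W = n ^ (-1 / 2) B ∘ L`, and if `|W t - W x| ≤ η + (c / 2) (t - x) ^ 2` for all `x` and `t`, then
the tangent at `x`, raised to height `F_n x + 2 ε + η`, majorizes `F_n`. Hence the least concave
majorant exceeds `F_n` by at most `2 ε + η` everywhere (`supAbs_leastConcaveMajorant_sub_le`).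

It remains to see that `η` may be taken of order `(log n / n) ^ (2 / 3)`. A union bound over a grid
of mesh `d = (log n / n) ^ (1 / 3)` and over the scales `2 ^ k d` shows that `η = M d ^ 2` fails
with probability at most a constant times `exp (-c' M)`, uniformly in `n`
(`HasSubgaussianIncrements.measure_scaled_quadratic_excess_le`). This exponential tail in `M` yields
the rate in probability and that of every moment.
-/

/-! ### Elementary bounds -/

theorem measure_iUnion_le_ofReal_of_geometric {Ω : Type*} [MeasurableSpace Ω] {P : Measure Ω}
    {E : ℕ → Set Ω} {c : ℝ} (hc : 0 ≤ c)
    (hE : ∀ k, P (E k) ≤ ENNReal.ofReal (c * (1 / 2) ^ k)) :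
    P (⋃ k, E k) ≤ ENNReal.ofReal (2 * c) := by
  calc P (⋃ k, E k) ≤ ∑' k, P (E k) := measure_iUnion_le E
    _ ≤ ∑' k, ENNReal.ofReal (c * (1 / 2) ^ k) := ENNReal.tsum_le_tsum hE
    _ = ENNReal.ofReal (∑' k : ℕ, c * (1 / 2) ^ k) :=
        (ENNReal.ofReal_tsum_of_nonneg (fun k => by positivity)
          (summable_geometric_two.mul_left c)).symm
    _ = ENNReal.ofReal (2 * c) := by rw [tsum_mul_left, tsum_geometric_two, mul_comm]

theorem exp_neg_natCast_mul_le {A : ℝ} (hA : 1 ≤ A) (k : ℕ) :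
    Real.exp (-(A * k)) ≤ (1 / 2) ^ k := by
  have h : Real.exp (-A) ≤ 1 / 2 := by
    rw [Real.exp_neg, one_div]
    exact inv_anti₀ two_pos (by linarith [Real.add_one_le_exp A])
  calc Real.exp (-(A * k)) = Real.exp (-A) ^ k := by rw [← Real.exp_nat_mul]; ring_nf
    _ ≤ (1 / 2) ^ k := by gcongr

/-! ### Gaussian increments -/

/-- `B` has almost surely continuous paths on `I`, and its increments there are sub-Gaussian with
variance proxy the length of the time interval. -/
structure HasSubgaussianIncrements {Ω : Type*} [MeasurableSpace Ω] (I : Set ℝ)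
    (B : ℝ → Ω → ℝ) (P : Measure Ω) : Prop where
  sub : ∀ s ∈ I, ∀ t ∈ I, HasSubgaussianMGF (fun ω => B t ω - B s ω) |t - s|.toNNReal P
  cont : ∀ᵐ ω ∂P, ContinuousOn (fun t => B t ω) I

theorem hasSubgaussianMGF_of_map_eq_gaussianReal {Ω : Type*} [MeasurableSpace Ω] {P : Measure Ω}
    {X : Ω → ℝ} {v c : ℝ≥0} (hm : AEMeasurable X P) (hX : P.map X = gaussianReal 0 v)
    (hv : v ≤ c) : HasSubgaussianMGF X c P where
  integrable_exp_mul t := by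
    have h := integrable_exp_mul_gaussianReal (μ := 0) (v := v) t
    rw [← hX] at h
    exact (integrable_map_measure h.aestronglyMeasurable hm).1 h
  mgf_le t := by
    rw [mgf_gaussianReal hX]
    have : (v : ℝ) ≤ c := hv
    rw [zero_mul, zero_add]
    gcongr

theorem hasSubgaussianIncrements_of_le {Ω : Type*} [MeasurableSpace Ω] {P : Measure Ω}
    {I : Set ℝ} {B : ℝ → Ω → ℝ} (hc : ∀ᵐ ω ∂P, ContinuousOn (fun t => B t ω) I)
    (h : ∀ s ∈ I, ∀ t ∈ I, s ≤ t →
      HasSubgaussianMGF (fun ω => B t ω - B s ω) (t - s).toNNReal P) :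
    HasSubgaussianIncrements I B P where
  cont := hc
  sub s hs t ht := by
    rcases le_total s t with hst | hts
    · rw [abs_of_nonneg (sub_nonneg.2 hst)]
      exact h s hs t ht hst
    · rw [abs_of_nonpos (sub_nonpos.2 hts)]
      convert! (h t ht s hs hts).neg using 1
      · ext ω; simp
      · rw [neg_sub]

theorem IsBrownianMotionOn.hasSubgaussianIncrements {Ω : Type*} [MeasurableSpace Ω]
    {P : Measure Ω} {I : Set ℝ} {B : ℝ → Ω → ℝ} (hB : IsBrownianMotionOn I B P) :
    HasSubgaussianIncrements I B P :=
  hasSubgaussianIncrements_of_le hB.cont fun s hs t ht hst =>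
    hasSubgaussianMGF_of_map_eq_gaussianReal (hB.hasLaw_sub s hs t ht hst).aemeasurable
      (hB.hasLaw_sub s hs t ht hst).map_eq le_rfl

/-- For a bridge on `[p, q]` the increment over `[s, t]` has variance
`(t - s) (1 - (t - s) / (q - p))`. -/
theorem IsBrownianBridgeOn.hasSubgaussianIncrements {Ω : Type*} [MeasurableSpace Ω]
    {P : Measure Ω} {p q : ℝ} {I : Set ℝ} {B : ℝ → Ω → ℝ}
    (hB : IsBrownianBridgeOn p q I B P) : HasSubgaussianIncrements I B P := by
  refine hasSubgaussianIncrements_of_le hB.cont fun s hs t ht hst => ?_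
  have := hB.gaussian.isProbabilityMeasure
  have hBs : HasGaussianLaw (B s) P := hB.gaussian.hasGaussianLaw_eval ⟨s, hs⟩
  have hBt : HasGaussianLaw (B t) P := hB.gaussian.hasGaussianLaw_eval ⟨t, ht⟩
  have hsub : HasGaussianLaw (B t - B s) P :=
    hB.gaussian.hasGaussianLaw_sub (s := ⟨t, ht⟩) (t := ⟨s, hs⟩)
  have hmean : ∫ ω, (B t - B s) ω ∂P = 0 := by
    simp only [Pi.sub_apply]
    rw [integral_sub hBt.integrable hBs.integrable, hB.mean t ht, hB.mean s hs, sub_zero]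
  have hpq : 0 < q - p := sub_pos.2 hB.lt
  have hvar : Var[B t - B s; P] ≤ t - s := by
    rw [variance_sub hBt.memLp_two hBs.memLp_two, ← covariance_self hBt.aemeasurable,
      ← covariance_self hBs.aemeasurable, covariance_comm (B t) (B s),
      hB.covariance t ht t ht le_rfl, hB.covariance s hs s hs le_rfl,
      hB.covariance s hs t ht hst]
    have : (t - p) * (q - t) / (q - p) - 2 * ((s - p) * (q - t) / (q - p)) +
        (s - p) * (q - s) / (q - p) = (t - s) - (t - s) ^ 2 / (q - p) := by
      field_simp
      ring
    rw [this]
    have : 0 ≤ (t - s) ^ 2 / (q - p) := by positivity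
    linarith
  have hmap := hsub.map_eq_gaussianReal
  rw [hmean] at hmap
  exact hasSubgaussianMGF_of_map_eq_gaussianReal hsub.aemeasurable hmap
    (Real.toNNReal_le_toNNReal hvar)

theorem HasSubgaussianIncrements.measure_lt_abs_sub_le {Ω : Type*} [MeasurableSpace Ω]
    {P : Measure Ω} [IsProbabilityMeasure P] {I : Set ℝ} {B : ℝ → Ω → ℝ}
    (hB : HasSubgaussianIncrements I B P) {s t h a : ℝ} (hs : s ∈ I) (ht : t ∈ I)
    (hst : |t - s| ≤ h) (hh : 0 < h) (ha : 0 ≤ a) :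
    P {ω | a < |B t ω - B s ω|} ≤ ENNReal.ofReal (2 * Real.exp (-(a ^ 2 / (2 * h)))) := by
  have key : ∀ s ∈ I, ∀ t ∈ I, |t - s| ≤ h →
      P {ω | a ≤ B t ω - B s ω} ≤ ENNReal.ofReal (Real.exp (-(a ^ 2 / (2 * h)))) := by
    intro s hs t ht hst
    have hmgf : HasSubgaussianMGF (fun ω => B t ω - B s ω) h.toNNReal P :=
      ⟨(hB.sub s hs t ht).integrable_exp_mul, fun u => ((hB.sub s hs t ht).mgf_le u).trans <| by
        have : ((|t - s|.toNNReal : ℝ≥0) : ℝ) ≤ (h.toNNReal : ℝ) :=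
          Real.toNNReal_le_toNNReal hst
        gcongr⟩
    have := hmgf.measure_ge_le ha
    rw [Real.coe_toNNReal _ hh.le, neg_div] at this
    rw [← ofReal_measureReal]
    exact ENNReal.ofReal_le_ofReal this
  calc P {ω | a < |B t ω - B s ω|}
      ≤ P ({ω | a ≤ B t ω - B s ω} ∪ {ω | a ≤ B s ω - B t ω}) := by
        refine measure_mono fun ω hω => ?_
        rcases lt_abs.1 (show a < |B t ω - B s ω| from hω) with h | h
        · exact Or.inl h.le
        · right
          change a ≤ B s ω - B t ω
          linarith
    _ ≤ _ := (measure_union_le _ _).trans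
        (add_le_add (key s hs t ht hst) (key t ht s hs (by rwa [abs_sub_comm])))
    _ = _ := by rw [← ENNReal.ofReal_add (by positivity) (by positivity), ← two_mul]

/-! ### Chaining and the tail bounds -/

/-- Dyadic chaining: a continuous function on `[0, 1]` whose increments between neighbouring dyadic
points of level `k` are at most `δ k` stays within `∑ k, δ k` of its initial value. -/
theorem abs_sub_le_of_dyadic_increments {g : ℝ → ℝ} (hg : ContinuousOn g (Icc 0 1)) {δ : ℕ → ℝ}
    (hδ : ∀ k, 0 ≤ δ k) {v : ℝ} (hv : ∀ n, ∑ k ∈ Finset.range n, δ k ≤ v)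
    (hd : ∀ k, ∀ j : ℕ, j < 2 ^ k → |g ((j + 1) / 2 ^ k) - g (j / 2 ^ k)| ≤ δ k)
    {θ : ℝ} (hθ : θ ∈ Icc (0 : ℝ) 1) : |g θ - g 0| ≤ v := by
  have hdy : ∀ k, ∀ j : ℕ, j ≤ 2 ^ k →
      |g (j / 2 ^ k) - g 0| ≤ ∑ i ∈ Finset.range (k + 1), δ i := by
    intro k
    induction k with
    | zero =>
      intro j hj
      have h0 := hd 0 0 (by norm_num)
      have : j = 0 ∨ j = 1 := by simp at hj; omega
      rcases this with rfl | rfl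
      · simpa using hδ 0
      · simpa using h0
    | succ k ih =>
      intro j hj
      have half : ∀ i : ℕ, ((2 * i : ℕ) : ℝ) / 2 ^ (k + 1) = i / 2 ^ k := by
        intro i
        push_cast
        rw [pow_succ]
        field_simp
      rw [Finset.sum_range_succ]
      rcases Nat.even_or_odd' j with ⟨i, rfl | rfl⟩
      · rw [half]
        have := ih i (by rw [pow_succ] at hj; omega)
        linarith [hδ (k + 1)]
      · have h1 := hd (k + 1) (2 * i) (by omega)
        have h2 := ih i (by rw [pow_succ] at hj; omega)
        rw [half] at h1
        rw [show ((2 * i + 1 : ℕ) : ℝ) = ((2 * i : ℕ) : ℝ) + 1 by push_cast; ring]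
        linarith [abs_sub_le (g ((((2 * i : ℕ) : ℝ) + 1) / 2 ^ (k + 1))) (g (i / 2 ^ k)) (g 0)]
  have hpow : ∀ k : ℕ, (0 : ℝ) < 2 ^ k := fun k => by positivity
  have hfl : ∀ k, (⌊θ * 2 ^ k⌋₊ : ℝ) / 2 ^ k ∈ Icc (0 : ℝ) 1 := fun k =>
    ⟨by positivity, (div_le_iff₀ (hpow k)).2 <| (Nat.floor_le
      (mul_nonneg hθ.1 (hpow k).le)).trans (mul_le_mul_of_nonneg_right hθ.2 (hpow k).le)⟩
  have htend : Tendsto (fun k : ℕ => (⌊θ * 2 ^ k⌋₊ : ℝ) / 2 ^ k) atTop (𝓝 θ) :=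
    (tendsto_nat_floor_mul_div_atTop hθ.1).comp
      (tendsto_pow_atTop_atTop_of_one_lt (one_lt_two : (1 : ℝ) < 2))
  have hlim : Tendsto (fun k : ℕ => g ((⌊θ * 2 ^ k⌋₊ : ℝ) / 2 ^ k)) atTop (𝓝 (g θ)) :=
    (hg θ hθ).tendsto.comp (tendsto_nhdsWithin_iff.2 ⟨htend, Eventually.of_forall hfl⟩)
  refine le_of_tendsto ((hlim.sub_const (g 0)).abs) (Eventually.of_forall fun k => ?_)
  refine (hdy k _ ?_).trans (hv _)
  have := (hfl k).2
  rw [div_le_one (hpow k)] at this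
  exact_mod_cast this

/-- Maximal inequality along the segment from `x` to `e`, which may run in either direction. The
weights `(1 / 4) (3 / 4) ^ k` of the chaining sum to `1`, and `2 (3 / 4) ^ 2 > 1` lets the Gaussian
tail beat the number `2 ^ k` of increments of level `k`. -/
theorem HasSubgaussianIncrements.measure_segment_le {Ω : Type*} [MeasurableSpace Ω]
    {P : Measure Ω} [IsProbabilityMeasure P] {I : Set ℝ} [hI : I.OrdConnected] {B : ℝ → Ω → ℝ}
    (hB : HasSubgaussianIncrements I B P) {x e u v : ℝ} (hx : x ∈ I) (he : e ∈ I)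
    (hu : 0 < u) (hxe : |e - x| ≤ u) (hv : 0 < v) :
    P {ω | ∃ θ ∈ Icc (0 : ℝ) 1, v < |B (x + (e - x) * θ) ω - B x ω|} ≤
      ENNReal.ofReal (Real.exp 16 * Real.exp (-(v ^ 2 / (32 * u)))) := by
  set l : ℝ := v ^ 2 / (32 * u) with hl
  -- for small exponents the right-hand side exceeds `1`
  rcases lt_or_ge l 16 with hsmall | hbig
  · refine prob_le_one.trans ?_
    rw [← Real.exp_add, ← ENNReal.ofReal_one]
    exact ENNReal.ofReal_le_ofReal (Real.one_le_exp (by linarith))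
  have hmem : ∀ θ ∈ Icc (0 : ℝ) 1, x + (e - x) * θ ∈ I := by
    intro θ hθ
    have := hI.convex hx he (sub_nonneg.2 hθ.2) hθ.1 (by ring)
    rwa [show (1 - θ) • x + θ • e = x + (e - x) * θ by simp only [smul_eq_mul]; ring] at this
  set δ : ℕ → ℝ := fun k => v * (1 / 4 * (3 / 4) ^ k)
  have hδ0 : ∀ k, 0 ≤ δ k := fun k => by positivity
  have hδv : ∀ n, ∑ k ∈ Finset.range n, δ k ≤ v := by
    intro n
    have hs : ∑ k ∈ Finset.range n, δ k = v * (1 - (3 / 4) ^ n) := by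
      rw [← Finset.mul_sum, ← Finset.mul_sum, geom_sum_eq (by norm_num)]
      ring
    rw [hs]
    have : (0 : ℝ) ≤ (3 / 4) ^ n := by positivity
    nlinarith
  set D : ℕ → ℕ → Set Ω := fun k j =>
    {ω | δ k < |B (x + (e - x) * ((j + 1) / 2 ^ k)) ω - B (x + (e - x) * (j / 2 ^ k)) ω|}
  have hDle : ∀ k, ∀ j ∈ Finset.range (2 ^ k), P (D k j) ≤
      ENNReal.ofReal (2 * Real.exp (-(l * (9 / 8) ^ k))) := by
    intro k j hj
    have hj' : (j : ℝ) + 1 ≤ 2 ^ k := by exact_mod_cast Finset.mem_range.1 hj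
    have hk : (0 : ℝ) < 2 ^ k := by positivity
    have h := hB.measure_lt_abs_sub_le (a := δ k) (h := u / 2 ^ k)
      (hmem (j / 2 ^ k) ⟨by positivity, (div_le_one hk).2 (by linarith)⟩)
      (hmem ((j + 1) / 2 ^ k) ⟨by positivity, (div_le_one hk).2 hj'⟩)
      (by
        rw [show x + (e - x) * ((j + 1) / 2 ^ k) - (x + (e - x) * (j / 2 ^ k)) =
          (e - x) / 2 ^ k by ring, abs_div, abs_of_pos hk]
        gcongr) (by positivity) (hδ0 k)
    refine h.trans_eq ?_
    have : δ k ^ 2 / (2 * (u / 2 ^ k)) = l * (9 / 8) ^ k := by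
      have h9 : (9 / 8 : ℝ) ^ k = ((3 / 4) ^ k) ^ 2 * 2 ^ k := by
        rw [← pow_mul, mul_comm k 2, pow_mul, ← mul_pow]
        norm_num
      rw [h9, hl]
      change (v * (1 / 4 * (3 / 4) ^ k)) ^ 2 / (2 * (u / 2 ^ k)) = _
      generalize (3 / 4 : ℝ) ^ k = c
      field_simp
      ring
    rw [this]
  have hE : ∀ k, P (⋃ j ∈ Finset.range (2 ^ k), D k j) ≤
      ENNReal.ofReal (2 * Real.exp (-l) * (1 / 2) ^ k) := by
    intro k
    have hb : 1 + (k : ℝ) * (1 / 8) ≤ (9 / 8) ^ k := by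
      have := one_add_mul_le_pow (a := (1 / 8 : ℝ)) (by norm_num) k
      norm_num at this ⊢
      linarith
    have hexp : Real.exp (-(l * (9 / 8) ^ k)) ≤ Real.exp (-l) * ((1 / 2) ^ k * (1 / 2) ^ k) := by
      have h1 := exp_neg_natCast_mul_le (A := l / 16) (by linarith) k
      calc Real.exp (-(l * (9 / 8) ^ k))
          ≤ Real.exp (-l + (-(l / 16 * k) + -(l / 16 * k))) := by
            refine Real.exp_le_exp.2 ?_
            nlinarith [mul_le_mul_of_nonneg_left hb (by linarith : (0 : ℝ) ≤ l)]
        _ = Real.exp (-l) * (Real.exp (-(l / 16 * k)) * Real.exp (-(l / 16 * k))) := by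
            rw [Real.exp_add, Real.exp_add]
        _ ≤ _ := by gcongr
    calc P (⋃ j ∈ Finset.range (2 ^ k), D k j)
        ≤ ∑ j ∈ Finset.range (2 ^ k), P (D k j) := measure_biUnion_finset_le _ _
      _ ≤ ∑ j ∈ Finset.range (2 ^ k), ENNReal.ofReal (2 * Real.exp (-(l * (9 / 8) ^ k))) :=
          Finset.sum_le_sum (hDle k)
      _ = ENNReal.ofReal (2 ^ k * (2 * Real.exp (-(l * (9 / 8) ^ k)))) := by
          rw [Finset.sum_const, Finset.card_range, nsmul_eq_mul,
            ENNReal.ofReal_mul (by positivity)]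
          norm_num
      _ ≤ _ := by
          refine ENNReal.ofReal_le_ofReal ?_
          have h2 : (2 : ℝ) ^ k * (1 / 2) ^ k = 1 := by rw [← mul_pow]; norm_num
          calc (2 : ℝ) ^ k * (2 * Real.exp (-(l * (9 / 8) ^ k)))
              ≤ 2 ^ k * (2 * (Real.exp (-l) * ((1 / 2) ^ k * (1 / 2) ^ k))) := by gcongr
            _ = 2 * Real.exp (-l) * (1 / 2) ^ k * ((2 : ℝ) ^ k * (1 / 2) ^ k) := by ring
            _ = _ := by rw [h2, mul_one]
  calc P {ω | ∃ θ ∈ Icc (0 : ℝ) 1, v < |B (x + (e - x) * θ) ω - B x ω|}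
      ≤ P (⋃ k, ⋃ j ∈ Finset.range (2 ^ k), D k j) := by
        refine measure_mono_ae ?_
        filter_upwards [hB.cont] with ω hω hbad
        by_contra hnot
        have hnot' : ∀ k, ∀ j : ℕ, j < 2 ^ k →
            |B (x + (e - x) * ((j + 1) / 2 ^ k)) ω - B (x + (e - x) * (j / 2 ^ k)) ω| ≤ δ k := by
          intro k j hj
          by_contra hlt
          exact hnot (mem_iUnion.2 ⟨k, mem_iUnion₂.2 ⟨j, Finset.mem_range.2 hj, not_le.1 hlt⟩⟩)
        obtain ⟨θ, hθ, hlt⟩ := hbad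
        have := abs_sub_le_of_dyadic_increments (g := fun θ => B (x + (e - x) * θ) ω)
          (hω.comp (by fun_prop) hmem) hδ0 hδv hnot' hθ
        simp only [mul_zero, add_zero] at this
        exact absurd hlt (not_lt.2 this)
    _ ≤ ENNReal.ofReal (2 * (2 * Real.exp (-l))) :=
        measure_iUnion_le_ofReal_of_geometric (by positivity) hE
    _ ≤ _ := by
        refine ENNReal.ofReal_le_ofReal ?_
        rw [← mul_assoc]
        gcongr
        linarith [Real.add_one_le_exp (16 : ℝ)]

theorem HasSubgaussianIncrements.measure_oscillation_le {Ω : Type*} [MeasurableSpace Ω]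
    {P : Measure Ω} [IsProbabilityMeasure P] {α β : ℝ} {B : ℝ → Ω → ℝ}
    (hB : HasSubgaussianIncrements (Icc α β) B P) {x u v : ℝ} (hx : x ∈ Icc α β)
    (hu : 0 < u) (hv : 0 < v) :
    P {ω | ∃ y ∈ Icc α β, |x - y| ≤ u ∧ v < |B x ω - B y ω|} ≤
      ENNReal.ofReal (2 * Real.exp 16 * Real.exp (-(v ^ 2 / (32 * u)))) := by
  set e₁ := min β (x + u)
  set e₂ := max α (x - u)
  have hx₁ : x ≤ e₁ := le_min hx.2 (by linarith)
  have hx₂ : e₂ ≤ x := max_le hx.1 (by linarith)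
  have h₁ := hB.measure_segment_le (e := e₁) hx ⟨hx.1.trans hx₁, min_le_left _ _⟩ hu
    (by rw [abs_of_nonneg (by linarith)]; linarith [min_le_right β (x + u)]) hv
  have h₂ := hB.measure_segment_le (e := e₂) hx ⟨le_max_left _ _, hx₂.trans hx.2⟩ hu
    (by rw [abs_of_nonpos (by linarith)]; linarith [le_max_right α (x - u)]) hv
  have hseg : ∀ y e : ℝ, 0 ≤ (y - x) * (e - x) → |y - x| ≤ |e - x| →
      ∃ θ ∈ Icc (0 : ℝ) 1, x + (e - x) * θ = y := by
    intro y e hs hle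
    rcases eq_or_ne (e - x) 0 with h0 | h0
    · refine ⟨0, ⟨le_rfl, zero_le_one⟩, ?_⟩
      rw [h0, abs_zero] at hle
      linarith [abs_nonpos_iff.1 hle]
    · refine ⟨(y - x) / (e - x), ⟨?_, ?_⟩, by field_simp; ring⟩
      · rw [← mul_div_mul_right _ _ h0]
        exact div_nonneg hs (mul_self_nonneg _)
      · refine (le_abs_self _).trans ?_
        rw [abs_div]
        exact div_le_one_of_le₀ hle (abs_nonneg _)
  refine (measure_mono ?_).trans (((measure_union_le _ _).trans (add_le_add h₁ h₂)).trans_eq ?_)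
  · rintro ω ⟨y, hy, hyu, hlt⟩
    rw [abs_sub_comm (B x ω)] at hlt
    rw [abs_sub_le_iff] at hyu
    rcases le_total x y with hxy | hyx
    · have hye : y ≤ e₁ := le_min hy.2 (by linarith)
      obtain ⟨θ, hθ, hθy⟩ := hseg y e₁ (mul_nonneg (by linarith) (by linarith))
        (by rw [abs_of_nonneg (by linarith), abs_of_nonneg (by linarith)]; linarith)
      exact Or.inl ⟨θ, hθ, by rwa [hθy]⟩
    · have hye : e₂ ≤ y := max_le hy.1 (by linarith)
      obtain ⟨θ, hθ, hθy⟩ := hseg y e₂ (mul_nonneg_of_nonpos_of_nonpos (by linarith) (by linarith))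
        (by rw [abs_of_nonpos (by linarith), abs_of_nonpos (by linarith)]; linarith)
      exact Or.inr ⟨θ, hθ, by rwa [hθy]⟩
  · rw [← ENNReal.ofReal_add (by positivity) (by positivity)]
    ring_nf

/-- Peeling: on `2 ^ k u ≤ z ≤ 2 ^ (k + 1) u` the parabola exceeds `v (2 ^ k u) ^ 2`, while the
process only oscillates on the scale `2 ^ (k + 1) u`. -/
theorem HasSubgaussianIncrements.measure_parabolic_le {Ω : Type*} [MeasurableSpace Ω]
    {P : Measure Ω} [IsProbabilityMeasure P] {α β : ℝ} {B : ℝ → Ω → ℝ}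
    (hB : HasSubgaussianIncrements (Icc α β) B P) {x u v : ℝ} (hx : x ∈ Icc α β)
    (hu : 0 < u) (hv : 0 < v) :
    P {ω | ∃ z : ℝ, u ≤ z ∧ x - z ∈ Icc α β ∧ 0 < B (x - z) ω - B x ω - v * z ^ 2} ≤
      ENNReal.ofReal (4 * Real.exp 16 * Real.exp (-(v ^ 2 * u ^ 3 / 64))) := by
  set l : ℝ := v ^ 2 * u ^ 3 / 64 with hl
  have hl0 : 0 ≤ l := by positivity
  rcases lt_or_ge l 1 with hsmall | hbig
  · refine prob_le_one.trans ?_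
    rw [← ENNReal.ofReal_one, mul_assoc, ← Real.exp_add]
    refine ENNReal.ofReal_le_ofReal ?_
    linarith [Real.one_le_exp (show (0 : ℝ) ≤ 16 + -l by linarith)]
  have hE : ∀ k : ℕ, P {ω | ∃ y ∈ Icc α β, |x - y| ≤ 2 ^ (k + 1) * u ∧
      v * (2 ^ k * u) ^ 2 < |B x ω - B y ω|} ≤
      ENNReal.ofReal (2 * Real.exp 16 * Real.exp (-l) * (1 / 2) ^ k) := by
    intro k
    refine (hB.measure_oscillation_le hx (by positivity) (by positivity)).trans
      (ENNReal.ofReal_le_ofReal ?_)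
    rw [mul_assoc _ (Real.exp (-l))]
    refine mul_le_mul_of_nonneg_left ?_ (by positivity)
    have heq : (v * (2 ^ k * u) ^ 2) ^ 2 / (32 * (2 ^ (k + 1) * u)) = l * 8 ^ k := by
      rw [show (8 : ℝ) = 2 ^ 3 by norm_num, ← pow_mul, mul_comm 3 k, pow_mul, pow_succ, hl]
      field_simp
      ring
    rw [heq]
    have hb : 1 + (k : ℝ) ≤ 8 ^ k := by
      have := one_add_mul_le_pow (a := (7 : ℝ)) (by norm_num) k
      norm_num at this ⊢
      linarith [(Nat.cast_nonneg k : (0 : ℝ) ≤ k)]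
    calc Real.exp (-(l * 8 ^ k)) ≤ Real.exp (-l + -(l * k)) :=
          Real.exp_le_exp.2 (by nlinarith [mul_le_mul_of_nonneg_left hb hl0])
      _ = Real.exp (-l) * Real.exp (-(l * k)) := Real.exp_add _ _
      _ ≤ _ := by gcongr; exact exp_neg_natCast_mul_le hbig k
  refine (measure_mono ?_).trans
    ((measure_iUnion_le_ofReal_of_geometric (by positivity) hE).trans_eq (by ring_nf))
  rintro ω ⟨z, huz, hz, hlt⟩
  obtain ⟨k, hk₁, hk₂⟩ := exists_nat_pow_near ((one_le_div hu).2 huz) one_lt_two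
  rw [le_div_iff₀ hu] at hk₁
  rw [div_lt_iff₀ hu] at hk₂
  refine mem_iUnion.2 ⟨k, x - z, hz, ?_, ?_⟩
  · rw [sub_sub_cancel, abs_of_nonneg (by linarith)]
    exact hk₂.le
  · have h1 : v * (2 ^ k * u) ^ 2 ≤ v * z ^ 2 := by gcongr
    rw [abs_sub_comm]
    exact h1.trans_lt ((by linarith : v * z ^ 2 < _).trans_le (le_abs_self _))

theorem HasSubgaussianIncrements.oscillationTailBound {Ω : Type*} [MeasurableSpace Ω]
    {P : Measure Ω} [IsProbabilityMeasure P] {α β : ℝ} {B : ℝ → Ω → ℝ}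
    (hB : HasSubgaussianIncrements (Icc α β) B P) :
    OscillationTailBound 1 (4 * Real.exp 16) (1 / 64) (Icc α β) B P := by
  intro x hx u hu v hv
  refine (hB.measure_oscillation_le hx hu.1 hv).trans (ENNReal.ofReal_le_ofReal ?_)
  rw [Real.rpow_neg_one]
  have hu0 := hu.1
  gcongr ?_ * Real.exp 16 * Real.exp ?_
  · norm_num
  · have : 0 ≤ v ^ 2 * u⁻¹ := by positivity
    rw [show v ^ 2 / (32 * u) = 1 / 32 * (v ^ 2 * u⁻¹) by field_simp]
    linarith

theorem HasSubgaussianIncrements.parabolicTailBound {Ω : Type*} [MeasurableSpace Ω]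
    {P : Measure Ω} [IsProbabilityMeasure P] {α β : ℝ} {B : ℝ → Ω → ℝ}
    (hB : HasSubgaussianIncrements (Icc α β) B P) :
    ParabolicTailBound 1 (4 * Real.exp 16) (1 / 64) (Icc α β) B P := by
  intro x hx u hu v hv
  refine (hB.measure_parabolic_le hx hu.1 hv).trans_eq ?_
  rw [show (4 - 1 : ℝ) = (3 : ℕ) by norm_num, Real.rpow_natCast]
  ring_nf

/-! ### Oscillation against a quadratic, uniformly on the interval -/

/-- Uniform oscillation bound: a grid of mesh `d` covers the first point, and the scales `2 ^ k d`
cover the distance of the second point to the grid. -/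
theorem HasSubgaussianIncrements.measure_quadratic_excess_le {Ω : Type*} [MeasurableSpace Ω]
    {P : Measure Ω} [IsProbabilityMeasure P] {α β : ℝ} {B : ℝ → Ω → ℝ}
    (hB : HasSubgaussianIncrements (Icc α β) B P) (hαβ : α ≤ β) {d σ κ M : ℝ} (hd : 0 < d)
    (hσ : 0 < σ) (hκ : 0 < κ) (hM : 10 * κ ≤ M) (hA : 512 * σ ^ 2 ≤ M * κ * d ^ 3) :
    P {ω | ∃ x ∈ Icc α β, ∃ y ∈ Icc α β,
        M * d ^ 2 + κ * (x - y) ^ 2 < σ * |B x ω - B y ω|} ≤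
      ENNReal.ofReal (((β - α) / d + 1) *
        (4 * Real.exp 16 * Real.exp (-(M * κ * d ^ 3 / (512 * σ ^ 2))))) := by
  set A : ℝ := M * κ * d ^ 3 / (512 * σ ^ 2) with hAdef
  have hA1 : 1 ≤ A := (one_le_div (by positivity)).2 hA
  have hM0 : 0 < M := by linarith
  set m : ℕ → ℝ := fun k => M / 4 + κ * 4 ^ k / 16 with hm
  set E : ℝ → ℕ → Set Ω := fun p k =>
    {ω | ∃ y ∈ Icc α β, |p - y| ≤ 2 ^ k * d ∧ d ^ 2 * m k / σ < |B p ω - B y ω|}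
  have hE : ∀ p ∈ Icc α β, ∀ k, P (E p k) ≤
      ENNReal.ofReal (2 * Real.exp 16 * Real.exp (-A) * (1 / 2) ^ k) := by
    intro p hp k
    refine (hB.measure_oscillation_le hp (by positivity) (by positivity)).trans
      (ENNReal.ofReal_le_ofReal ?_)
    rw [mul_assoc _ (Real.exp (-A))]
    refine mul_le_mul_of_nonneg_left ?_ (by positivity)
    have h4 : (4 : ℝ) ^ k = 2 ^ k * 2 ^ k := by rw [← mul_pow]; norm_num
    have hb : 1 + (k : ℝ) ≤ 2 ^ k := by
      have := one_add_mul_le_pow (a := (1 : ℝ)) (by norm_num) k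
      norm_num at this ⊢
      linarith
    -- By the arithmetic-geometric mean inequality, `m k ^ 2 ≥ M κ 4 ^ k / 16`.
    have hAk : A * 2 ^ k ≤ (d ^ 2 * m k / σ) ^ 2 / (32 * (2 ^ k * d)) := by
      have : (d ^ 2 * m k / σ) ^ 2 / (32 * (2 ^ k * d)) - A * 2 ^ k =
          d ^ 3 * (M / 4 - κ * 4 ^ k / 16) ^ 2 / (32 * σ ^ 2 * 2 ^ k) := by
        rw [hAdef, hm]
        simp only [h4]
        field_simp
        ring
      have h0 : 0 ≤ d ^ 3 * (M / 4 - κ * 4 ^ k / 16) ^ 2 / (32 * σ ^ 2 * 2 ^ k) := by positivity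
      linarith
    calc Real.exp (-((d ^ 2 * m k / σ) ^ 2 / (32 * (2 ^ k * d))))
        ≤ Real.exp (-A + -(A * k)) := by
          refine Real.exp_le_exp.2 ?_
          nlinarith [mul_le_mul_of_nonneg_left hb (by linarith : (0 : ℝ) ≤ A)]
      _ = Real.exp (-A) * Real.exp (-(A * k)) := Real.exp_add _ _
      _ ≤ _ := by gcongr; exact exp_neg_natCast_mul_le hA1 k
  set N : ℕ := ⌊(β - α) / d⌋₊
  have hN' : (N : ℝ) ≤ (β - α) / d := Nat.floor_le (div_nonneg (by linarith) hd.le)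
  have hgrid : ∀ j ∈ Finset.range (N + 1), α + j * d ∈ Icc α β := by
    intro j hj
    have h1 : (j : ℝ) ≤ (β - α) / d :=
      le_trans (by exact_mod_cast Nat.lt_succ_iff.1 (Finset.mem_range.1 hj)) hN'
    rw [le_div_iff₀ hd] at h1
    exact ⟨by nlinarith [(Nat.cast_nonneg j : (0 : ℝ) ≤ j)], by linarith⟩
  calc P {ω | ∃ x ∈ Icc α β, ∃ y ∈ Icc α β,
        M * d ^ 2 + κ * (x - y) ^ 2 < σ * |B x ω - B y ω|}
      ≤ P (⋃ j ∈ Finset.range (N + 1), ⋃ k, E (α + j * d) k) := by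
        refine measure_mono ?_
        rintro ω ⟨x, hx, y, hy, hlt⟩
        by_contra hnot
        simp only [mem_iUnion, not_exists] at hnot
        have hxd : 0 ≤ (x - α) / d := div_nonneg (by linarith [hx.1]) hd.le
        set j : ℕ := ⌊(x - α) / d⌋₊
        have hjr : j ∈ Finset.range (N + 1) := by
          refine Finset.mem_range.2 (Nat.lt_succ_of_le (Nat.floor_le_floor ?_))
          gcongr
          exact hx.2
        set p : ℝ := α + j * d
        have hj1 : (j : ℝ) * d ≤ x - α := (le_div_iff₀ hd).1 (Nat.floor_le hxd)
        have hj2 : x - α < (j + 1) * d := (div_lt_iff₀ hd).1 (Nat.lt_floor_add_one _)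
        have hpx : |p - x| ≤ d := by
          rw [abs_le]
          constructor <;> simp only [p] <;> linarith
        have hnot' : ∀ k, ∀ z ∈ Icc α β, |p - z| ≤ 2 ^ k * d →
            σ * |B p ω - B z ω| ≤ d ^ 2 * m k := by
          intro k z hz hzk
          have : ¬ (d ^ 2 * m k / σ < |B p ω - B z ω|) :=
            fun h => hnot j hjr k ⟨z, hz, hzk, h⟩
          rw [mul_comm]
          exact (le_div_iff₀ hσ).1 (not_lt.1 this)
        obtain ⟨k, hk1, hk2⟩ := exists_nat_pow_near
          (show 1 ≤ |p - y| / d + 1 by linarith [div_nonneg (abs_nonneg (p - y)) hd.le])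
          (one_lt_two : (1 : ℝ) < 2)
        have hx0 := hnot' 0 x hx (by simpa using hpx)
        have hyk := hnot' (k + 1) y hy (by
          have : |p - y| / d ≤ 2 ^ (k + 1) := by linarith
          exact (div_le_iff₀ hd).1 this)
        have hsum : σ * |B x ω - B y ω| ≤ σ * |B p ω - B x ω| + σ * |B p ω - B y ω| := by
          rw [← mul_add]
          refine mul_le_mul_of_nonneg_left ?_ hσ.le
          rw [abs_sub_comm (B p ω) (B x ω)]
          exact abs_sub_le _ _ _
        have hpow : 2 ^ k * d ≤ |x - y| + 2 * d := by
          have h1 : 2 ^ k * d ≤ |p - y| + d := by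
            have := mul_le_mul_of_nonneg_right hk1 hd.le
            rwa [add_mul, div_mul_cancel₀ _ hd.ne', one_mul] at this
          linarith [abs_sub_le p x y]
        have hsq : (4 : ℝ) ^ k * d ^ 2 ≤ 2 * (x - y) ^ 2 + 8 * d ^ 2 := by
          have h1 : (2 ^ k * d) ^ 2 ≤ (|x - y| + 2 * d) ^ 2 := by gcongr
          have h2 : (2 ^ k * d) ^ 2 = 4 ^ k * d ^ 2 := by
            rw [mul_pow, ← pow_mul, mul_comm k 2, pow_mul]
            norm_num
          nlinarith [sq_nonneg (|x - y| - 2 * d), sq_abs (x - y)]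
        have hd2 : 0 < d ^ 2 := by positivity
        have hfin : d ^ 2 * m 0 + d ^ 2 * m (k + 1) ≤ M * d ^ 2 + κ * (x - y) ^ 2 := by
          simp only [hm, pow_succ (4 : ℝ) k, pow_zero]
          nlinarith [mul_le_mul_of_nonneg_left hsq hκ.le, mul_le_mul_of_nonneg_right hM hd2.le]
        linarith
    _ ≤ ∑ j ∈ Finset.range (N + 1), P (⋃ k, E (α + j * d) k) := measure_biUnion_finset_le _ _
    _ ≤ ∑ j ∈ Finset.range (N + 1), ENNReal.ofReal (2 * (2 * Real.exp 16 * Real.exp (-A))) :=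
        Finset.sum_le_sum fun j hj =>
          measure_iUnion_le_ofReal_of_geometric (by positivity) (hE _ (hgrid j hj))
    _ = ENNReal.ofReal ((N + 1) * (4 * Real.exp 16 * Real.exp (-A))) := by
        rw [Finset.sum_const, Finset.card_range, nsmul_eq_mul, ← ENNReal.ofReal_natCast,
          ← ENNReal.ofReal_mul (Nat.cast_nonneg _), Nat.cast_succ]
        ring_nf
    _ ≤ _ := ENNReal.ofReal_le_ofReal (by gcongr)

theorem one_le_log_natCast {n : ℕ} (hn : 3 ≤ n) : 1 ≤ Real.log n := by
  rw [Real.le_log_iff_exp_le (by positivity)]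
  have : (3 : ℝ) ≤ n := by exact_mod_cast hn
  linarith [Real.exp_one_lt_d9]

/-- The mesh `d = (log n / n) ^ (1 / 3)` balances the parabola `d ^ 2` against the oscillation
`(d log n / n) ^ (1 / 2)`: with `σ = n ^ (-1 / 2)` one has `d ^ 3 / σ ^ 2 = log n`, so that for
large `M` the Gaussian tail beats the number of grid points. -/
theorem HasSubgaussianIncrements.measure_scaled_quadratic_excess_le {Ω : Type*}
    [MeasurableSpace Ω] {P : Measure Ω} [IsProbabilityMeasure P] {α β : ℝ} {B : ℝ → Ω → ℝ}
    (hB : HasSubgaussianIncrements (Icc α β) B P) (hαβ : α ≤ β) {κ M : ℝ} (hκ : 0 < κ)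
    (hM : 10 * κ ≤ M) (hM' : 1024 / κ ≤ M) {n : ℕ} (hn : 3 ≤ n) :
    P {ω | ∃ x ∈ Icc α β, ∃ y ∈ Icc α β,
        M * (Real.log n / n) ^ (2 / 3 : ℝ) + κ * (x - y) ^ 2 <
          (n : ℝ) ^ (-(1 / 2) : ℝ) * |B x ω - B y ω|} ≤
      ENNReal.ofReal ((β - α + 1) * (4 * Real.exp 16) * Real.exp (-(κ / 1024 * M))) := by
  have hlog := one_le_log_natCast hn
  have hn0 : (0 : ℝ) < n := by positivity
  have hn1 : (1 : ℝ) ≤ n := by exact_mod_cast (by omega : 1 ≤ n)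
  have hq : 0 < Real.log n / n := by positivity
  set d : ℝ := (Real.log n / n) ^ (1 / 3 : ℝ) with hd
  set σ : ℝ := (n : ℝ) ^ (-(1 / 2) : ℝ) with hσ
  have hd0 : 0 < d := Real.rpow_pos_of_pos hq _
  have hσ0 : 0 < σ := Real.rpow_pos_of_pos hn0 _
  have hd2 : (Real.log n / n) ^ (2 / 3 : ℝ) = d ^ 2 := by
    rw [hd, ← Real.rpow_mul_natCast hq.le]
    norm_num
  have hd3 : d ^ 3 = Real.log n / n := by
    rw [hd, ← Real.rpow_mul_natCast hq.le]
    norm_num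
  have hσ2 : σ ^ 2 = (n : ℝ)⁻¹ := by
    rw [hσ, ← Real.rpow_mul_natCast hn0.le]
    norm_num [Real.rpow_neg_one]
  have hκM : 1024 ≤ M * κ := (div_le_iff₀ hκ).1 hM'
  have hdn : (n : ℝ)⁻¹ ≤ d := by
    refine le_of_pow_le_pow_left₀ three_ne_zero hd0.le ?_
    rw [hd3, inv_pow, div_eq_mul_inv]
    calc ((n : ℝ) ^ 3)⁻¹ ≤ (n : ℝ)⁻¹ := inv_anti₀ hn0 (le_self_pow₀ hn1 three_ne_zero)
      _ ≤ _ := le_mul_of_one_le_left (by positivity) hlog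
  have hA : M * κ * d ^ 3 / (512 * σ ^ 2) = M * κ * Real.log n / 512 := by
    rw [hd3, hσ2]
    field_simp
  have key := hB.measure_quadratic_excess_le hαβ hd0 hσ0 hκ hM (by
    rw [← one_le_div (by positivity), hA]
    nlinarith)
  rw [hA] at key
  rw [hd2]
  refine key.trans (ENNReal.ofReal_le_ofReal ?_)
  have hgrid : (β - α) / d + 1 ≤ (β - α + 1) * n := by
    have h1 : (β - α) / d ≤ (β - α) * n := by
      rw [div_eq_mul_inv]
      refine mul_le_mul_of_nonneg_left ?_ (by linarith)
      exact inv_le_of_inv_le₀ hn0 hdn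
    linarith
  have hexp : n * Real.exp (-(M * κ * Real.log n / 512)) ≤ Real.exp (-(κ / 1024 * M)) := by
    conv_lhs => rw [← Real.exp_log hn0]
    rw [← Real.exp_add, Real.log_exp]
    refine Real.exp_le_exp.2 ?_
    nlinarith
  calc ((β - α) / d + 1) * (4 * Real.exp 16 * Real.exp (-(M * κ * Real.log n / 512)))
      ≤ (β - α + 1) * n * (4 * Real.exp 16 * Real.exp (-(M * κ * Real.log n / 512))) := by gcongr
    _ = (β - α + 1) * (4 * Real.exp 16) * (n * Real.exp (-(M * κ * Real.log n / 512))) := by ring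
    _ ≤ _ := by
        refine mul_le_mul_of_nonneg_left hexp ?_
        have : 0 ≤ β - α + 1 := by linarith
        positivity

/-! ### The tangent-line comparison -/

/-- One affine majorant with value `g x + e` at `x` suffices. It also shows that the infimum
defining the least concave majorant is over a nonempty set. -/
theorem abs_leastConcaveMajorant_sub_le {S : Set ℝ} (hS : Convex ℝ S) {g : ℝ → ℝ} {x m e : ℝ}
    (hx : x ∈ S) (h : ∀ t ∈ S, g t ≤ g x + e + m * (t - x)) :
    |leastConcaveMajorant S g x - g x| ≤ e := by
  have haff : ConcaveOn ℝ S (fun t => g x + e + m * (t - x)) := by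
    refine ⟨hS, fun s _ t _ p q _ _ hpq => le_of_eq ?_⟩
    simp only [smul_eq_mul]
    linear_combination (g x + e - m * x) * hpq
  have hle : leastConcaveMajorant S g x ≤ g x + e :=
    csInf_le ⟨g x, by rintro y ⟨h, -, hgh, rfl⟩; exact hgh x hx⟩ ⟨_, haff, h, by simp⟩
  have hge : g x ≤ leastConcaveMajorant S g x :=
    le_csInf ⟨_, _, haff, h, rfl⟩ (by rintro y ⟨h, -, hgh, rfl⟩; exact hgh x hx)
  rw [abs_le]
  constructor <;> linarith

theorem IsRegularDecreasing.exists_antitoneOn_add_mul {f : ℝ → ℝ} {a b : ℝ}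
    (hf : IsRegularDecreasing f a b) :
    ∃ c : ℝ, 0 < c ∧ AntitoneOn (fun t => f t + c * t) (Icc a b) := by
  obtain ⟨c, C, hc, hbd⟩ := hf.bounds
  have hdiff := hf.contDiffOn.differentiableOn one_ne_zero
  have hder : ∀ t ∈ interior (Icc a b), HasDerivAt f (deriv f t) t := fun t ht =>
    ((hdiff t (interior_subset ht)).differentiableAt (mem_interior_iff_mem_nhds.1 ht)).hasDerivAt
  refine ⟨c, hc, antitoneOn_of_hasDerivWithinAt_nonpos (f' := fun t => deriv f t + c * 1)
    (convex_Icc a b) (hdiff.continuousOn.add (by fun_prop)) (fun t ht =>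
      ((hder t ht).add ((hasDerivAt_id t).const_mul c)).hasDerivWithinAt) fun t ht => ?_⟩
  have h1 := (hbd t (interior_subset ht)).1
  have h2 : derivWithin f (Icc a b) t ≤ 0 := hf.antitoneOn.derivWithin_nonpos
  rw [abs_of_nonpos h2, derivWithin_of_mem_nhds (mem_interior_iff_mem_nhds.1 ht)] at h1
  linarith

/-- The primitive of `f` is strongly concave when `t ↦ f t + c t` is decreasing. -/
theorem integral_le_affine_sub_quadratic {f : ℝ → ℝ} {a b c : ℝ}
    (hf : ContinuousOn f (Icc a b)) (hanti : AntitoneOn (fun t => f t + c * t) (Icc a b))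
    {x t : ℝ} (hx : x ∈ Icc a b) (ht : t ∈ Icc a b) :
    ∫ s in a..t, f s ≤ (∫ s in a..x, f s) + f x * (t - x) - c / 2 * (t - x) ^ 2 := by
  have hint : ∀ u ∈ Icc a b, ∀ v ∈ Icc a b, IntervalIntegrable f volume u v := fun u hu v hv =>
    (hf.mono (ordConnected_Icc.uIcc_subset hu hv)).intervalIntegrable
  have ha : a ∈ Icc a b := ⟨le_rfl, hx.1.trans hx.2⟩
  have hadd := intervalIntegral.integral_add_adjacent_intervals (hint a ha x hx) (hint x hx t ht)
  have hlin : ∫ s in x..t, (f x + c * x - c * s) = f x * (t - x) - c / 2 * (t - x) ^ 2 := by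
    rw [intervalIntegral.integral_sub (by simp) ((by fun_prop : Continuous fun s : ℝ =>
      c * s).intervalIntegrable _ _), intervalIntegral.integral_const,
      intervalIntegral.integral_const_mul, integral_id, smul_eq_mul]
    ring
  have hle : ∫ s in x..t, f s ≤ ∫ s in x..t, (f x + c * x - c * s) := by
    have hci : ∀ u v : ℝ, IntervalIntegrable (fun s : ℝ => f x + c * x - c * s) volume u v :=
      fun u v => (by fun_prop : Continuous fun s : ℝ => f x + c * x - c * s).intervalIntegrable _ _
    rcases le_total x t with hxt | htx
    · refine intervalIntegral.integral_mono_on hxt (hint x hx t ht) (hci _ _) fun s hs => ?_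
      have := hanti hx ⟨hx.1.trans hs.1, hs.2.trans ht.2⟩ hs.1
      simp only at this
      linarith
    · rw [intervalIntegral.integral_symm t x, intervalIntegral.integral_symm t x, neg_le_neg_iff]
      refine intervalIntegral.integral_mono_on htx (hci _ _) (hint t ht x hx) fun s hs => ?_
      have := hanti ⟨ht.1.trans hs.1, hs.2.trans hx.2⟩ hx hs.2
      simp only at this
      linarith
  linarith

theorem IsRegularIncreasing.exists_lipschitz {L : ℝ → ℝ} {a b : ℝ}
    (hL : IsRegularIncreasing L a b) :
    ∃ C : ℝ, 0 < C ∧ ∀ s ∈ Icc a b, ∀ t ∈ Icc a b, |L t - L s| ≤ C * |t - s| := by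
  obtain ⟨c, C, hc, hbd⟩ := hL.bounds
  refine ⟨max C 1, by positivity, fun s hs t ht => ?_⟩
  refine (convex_Icc a b).norm_image_sub_le_of_norm_derivWithin_le
    (hL.contDiffOn.differentiableOn one_ne_zero) (fun u hu => ?_) hs ht
  rw [Real.norm_of_nonneg (hc.le.trans (hbd u hu).1)]
  exact (hbd u hu).2.trans (le_max_left _ _)

/-- If `g` is within `supAbs` of `F + W`, where `F` is strongly concave and the increments of `W`
exceed half of the concavity of `F` by at most `η`, then the tangent line of `F` at `x`, raised by
`2 supAbs + η` to start above `g x`, majorizes `g`. -/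
theorem supAbs_leastConcaveMajorant_sub_le {S : Set ℝ} (hS : Convex ℝ S) {g F W f : ℝ → ℝ}
    {c η : ℝ} (hF : ∀ x ∈ S, ∀ t ∈ S, F t ≤ F x + f x * (t - x) - c / 2 * (t - x) ^ 2)
    (hW : ∀ x ∈ S, ∀ t ∈ S, |W t - W x| ≤ η + c / 2 * (t - x) ^ 2) :
    supAbs S (fun x => leastConcaveMajorant S g x - g x) ≤
      2 * supAbs S (fun t => g t - F t - W t) + ENNReal.ofReal η := by
  rcases eq_or_ne (supAbs S (fun t => g t - F t - W t)) ∞ with htop | htop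
  · rw [htop, ENNReal.mul_top two_ne_zero, top_add]
    exact le_top
  set ε : ℝ := (supAbs S (fun t => g t - F t - W t)).toReal with hε
  have hbd : ∀ t ∈ S, |g t - F t - W t| ≤ ε := by
    intro t ht
    have h : ‖g t - F t - W t‖ₑ ≤ supAbs S (fun t => g t - F t - W t) :=
      le_iSup₂ (f := fun t (_ : t ∈ S) => ‖g t - F t - W t‖ₑ) t ht
    have := ENNReal.toReal_mono htop h
    rwa [toReal_enorm, Real.norm_eq_abs] at this
  refine iSup₂_le fun x hx => ?_
  have hη : 0 ≤ η := by simpa using (abs_nonneg _).trans (hW x hx x hx)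
  have h := abs_leastConcaveMajorant_sub_le (g := g) (m := f x) (e := 2 * ε + η) hS hx
    fun t ht => by
      have h1 := abs_le.1 (hbd t ht)
      have h2 := abs_le.1 (hbd x hx)
      have h3 := abs_le.1 (hW x hx t ht)
      linarith [hF x hx t ht]
  rw [← ENNReal.ofReal_toReal htop, ← hε, ← ENNReal.ofReal_ofNat,
    ← ENNReal.ofReal_mul (by norm_num), ← ENNReal.ofReal_add (by positivity) hη,
    ← ofReal_norm, Real.norm_eq_abs]
  exact ENNReal.ofReal_le_ofReal h

/-! ### Transfer of rates in probability and in mean -/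

theorem isBigOInProb_of_le_two_mul_add {Ω : ℕ → Type*} [∀ n, MeasurableSpace (Ω n)]
    {P : ∀ n, Measure (Ω n)} {X Y : ∀ n, Ω n → ℝ≥0∞} {γ ρ : ℕ → ℝ}
    {bad : ∀ n, ℝ → Set (Ω n)} {K c M₀ : ℝ} {n₀ : ℕ} (hc : 0 < c) (hρ : ∀ n, 0 ≤ ρ n)
    (hbad : ∀ n, n₀ ≤ n → ∀ M, M₀ ≤ M → P n (bad n M) ≤ ENNReal.ofReal (K * Real.exp (-(c * M))))
    (hY : ∀ n M ω, ω ∉ bad n M → Y n ω ≤ 2 * X n ω + ENNReal.ofReal (M * ρ n))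
    (hγ : γ =O[atTop] ρ) (hX : IsBigOInProb P X γ) : IsBigOInProb P Y ρ := by
  intro ε hε
  obtain ⟨M₁, hM₁⟩ := hX (ε / 2) (ENNReal.half_pos hε.ne')
  obtain ⟨C, hC0, hC⟩ := hγ.exists_pos
  have hlim : Tendsto (fun M : ℝ => ENNReal.ofReal (K * Real.exp (-(c * M)))) atTop (𝓝 0) := by
    have h1 : Tendsto (fun M : ℝ => K * Real.exp (-(c * M))) atTop (𝓝 (K * 0)) :=
      (Real.tendsto_exp_neg_atTop_nhds_zero.comp (tendsto_id.const_mul_atTop hc)).const_mul K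
    have := ENNReal.tendsto_ofReal h1
    rwa [mul_zero, ENNReal.ofReal_zero] at this
  obtain ⟨M, hMε, hMM₀, hM0⟩ := ((hlim.eventually_le_const (ENNReal.half_pos hε.ne')).and
    ((eventually_ge_atTop M₀).and (eventually_ge_atTop 0))).exists
  refine ⟨(2 * M₁ * C + M).toNNReal, ?_⟩
  filter_upwards [hM₁, hC.bound, eventually_ge_atTop n₀] with n hn₁ hn₂ hn₃
  rw [Real.norm_eq_abs, Real.norm_eq_abs, abs_of_nonneg (hρ n)] at hn₂
  rw [abs_of_nonneg (hρ n)]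
  calc P n {ω | ((2 * M₁ * C + M).toNNReal : ℝ≥0∞) * ENNReal.ofReal (ρ n) < Y n ω}
      ≤ P n ({ω | (M₁ : ℝ≥0∞) * ENNReal.ofReal |γ n| < X n ω} ∪ bad n M) := by
        refine measure_mono fun ω hω => ?_
        by_contra hnot
        rw [mem_union, not_or] at hnot
        have hXle : X n ω ≤ (M₁ : ℝ≥0∞) * ENNReal.ofReal |γ n| := not_lt.1 hnot.1
        refine absurd (show _ < Y n ω from hω) (not_lt.2 ((hY n M ω hnot.2).trans ?_))
        calc 2 * X n ω + ENNReal.ofReal (M * ρ n)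
            ≤ 2 * ((M₁ : ℝ≥0∞) * ENNReal.ofReal |γ n|) + ENNReal.ofReal (M * ρ n) := by gcongr
          _ = ENNReal.ofReal (2 * (M₁ * |γ n|) + M * ρ n) := by
              rw [ENNReal.ofReal_add (by positivity) (mul_nonneg hM0 (hρ n)),
                ENNReal.ofReal_mul two_pos.le, ENNReal.ofReal_mul M₁.coe_nonneg,
                ENNReal.ofReal_coe_nnreal, ENNReal.ofReal_ofNat]
          _ ≤ ENNReal.ofReal ((2 * M₁ * C + M) * ρ n) := by
              refine ENNReal.ofReal_le_ofReal ?_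
              have := mul_le_mul_of_nonneg_left hn₂ M₁.coe_nonneg
              linarith
          _ = _ := ENNReal.ofReal_mul (by positivity)
    _ ≤ _ := (measure_union_le _ _).trans (add_le_add hn₁ ((hbad n hn₃ M hMM₀).trans hMε))
    _ = ε := ENNReal.add_halves ε

/-- The excess of `Y` over `2 X` is dominated by a sum of indicators of measurable hulls of the
exceptional sets. As that sum is measurable, the lower integral splits whether or not `X` and `Y`
are measurable. -/
theorem isBigOMoment_of_le_two_mul_add {Ω : ℕ → Type*} [∀ n, MeasurableSpace (Ω n)]
    {P : ∀ n, Measure (Ω n)} [∀ n, IsProbabilityMeasure (P n)] {X Y : ∀ n, Ω n → ℝ≥0∞}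
    {ρ : ℕ → ℝ} {bad : ∀ n, ℝ → Set (Ω n)} {K c M₀ r : ℝ} {n₀ : ℕ} (hK : 0 ≤ K) (hc : 0 < c)
    (hr : 1 ≤ r) (hρ : ∀ n, 0 ≤ ρ n)
    (hbad : ∀ n, n₀ ≤ n → ∀ M, M₀ ≤ M → P n (bad n M) ≤ ENNReal.ofReal (K * Real.exp (-(c * M))))
    (hY : ∀ n M ω, ω ∉ bad n M → Y n ω ≤ 2 * X n ω + ENNReal.ofReal (M * ρ n))
    (hX : IsBigOMoment P X r (fun n => ρ n ^ r)) : IsBigOMoment P Y r (fun n => ρ n ^ r) := by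
  obtain ⟨C, hC⟩ := hX
  have hr0 : 0 ≤ r := by linarith
  set m₀ : ℕ := ⌈M₀⌉₊
  set w : ℕ → ℝ := fun i => ((m₀ + i + 1 : ℕ) : ℝ) ^ r with hw
  have hw0 : ∀ i, 0 ≤ w i := fun i => by positivity
  have hsummable : Summable fun i : ℕ => w i * (K * Real.exp (-(c * (m₀ + i : ℕ)))) := by
    have h1 := (summable_nat_add_iff (m₀ + 1)).2
      (Real.summable_pow_mul_exp_neg_nat_mul ⌈r⌉₊ hc)
    refine Summable.of_nonneg_of_le (fun i => by positivity) (fun i => ?_)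
      (h1.mul_left (K * Real.exp c))
    have h2 : w i ≤ ((i + (m₀ + 1) : ℕ) : ℝ) ^ ⌈r⌉₊ := by
      rw [← Real.rpow_natCast, show i + (m₀ + 1) = m₀ + i + 1 by ring]
      exact Real.rpow_le_rpow_of_exponent_le (by exact_mod_cast Nat.le_add_left 1 _)
        (Nat.le_ceil r)
    have h3 : Real.exp (-(c * (m₀ + i : ℕ))) =
        Real.exp c * Real.exp (-c * ((i + (m₀ + 1) : ℕ) : ℝ)) := by
      rw [← Real.exp_add]
      push_cast
      ring_nf
    rw [h3]
    calc w i * (K * (Real.exp c * Real.exp (-c * ((i + (m₀ + 1) : ℕ) : ℝ))))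
        ≤ ((i + (m₀ + 1) : ℕ) : ℝ) ^ ⌈r⌉₊ *
          (K * (Real.exp c * Real.exp (-c * ((i + (m₀ + 1) : ℕ) : ℝ)))) := by gcongr
      _ = _ := by ring
  set T : ℝ := ∑' i : ℕ, w i * (K * Real.exp (-(c * (m₀ + i : ℕ)))) with hT
  have hT0 : 0 ≤ T := tsum_nonneg fun i => by positivity
  refine ⟨((2 : ℝ≥0∞) ^ (r - 1) * (2 ^ r * C + ENNReal.ofReal ((m₀ : ℝ) ^ r + T))).toNNReal, ?_⟩
  rw [ENNReal.coe_toNNReal (by finiteness)]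
  filter_upwards [hC, eventually_ge_atTop n₀] with n hn hnn₀
  have hρr : 0 ≤ ρ n ^ r := Real.rpow_nonneg (hρ n) r
  rw [abs_of_nonneg hρr] at hn ⊢
  set H : ℕ → Set (Ω n) := fun i => toMeasurable (P n) (bad n (m₀ + i : ℕ))
  set V : Ω n → ℝ≥0∞ := fun ω => ENNReal.ofReal ((m₀ : ℝ) ^ r) +
    ∑' i, (H i).indicator (fun _ => ENNReal.ofReal (w i)) ω with hV
  have hVm : Measurable V := by
    have hind : ∀ i, Measurable ((H i).indicator fun _ => ENNReal.ofReal (w i)) := fun i =>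
      measurable_const.indicator (measurableSet_toMeasurable _ _)
    have hsum : Measurable fun ω => ∑' i, (H i).indicator (fun _ => ENNReal.ofReal (w i)) ω :=
      Measurable.tsum hind
    exact measurable_const.add hsum
  have hVint : ∫⁻ ω, V ω ∂(P n) ≤ ENNReal.ofReal ((m₀ : ℝ) ^ r + T) := by
    rw [hV, lintegral_add_left measurable_const, lintegral_const, measure_univ, mul_one,
      lintegral_tsum fun i =>
        (measurable_const.indicator (measurableSet_toMeasurable _ _)).aemeasurable,
      ENNReal.ofReal_add (by positivity) hT0, hT,
      ENNReal.ofReal_tsum_of_nonneg (fun i => by positivity) hsummable]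
    gcongr with i
    rw [lintegral_indicator_const (measurableSet_toMeasurable _ _), measure_toMeasurable,
      ENNReal.ofReal_mul (hw0 i)]
    gcongr
    refine hbad n hnn₀ _ ((Nat.le_ceil M₀).trans ?_)
    exact_mod_cast Nat.le_add_right m₀ i
  have hpt : ∀ᵐ ω ∂(P n), Y n ω ^ r ≤
      2 ^ (r - 1) * ((2 * X n ω) ^ r + ENNReal.ofReal (ρ n ^ r) * V ω) := by
    filter_upwards [ae_lt_top hVm (hVint.trans_lt ENNReal.ofReal_lt_top).ne] with ω hVω
    have hex : ∃ i, ω ∉ H i := by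
      -- every weight is at least `1`, so `V` is infinite on the intersection of the hulls
      by_contra! hall
      refine hVω.ne (top_unique (le_trans ?_ le_add_self))
      rw [← ENNReal.tsum_const_eq_top_of_ne_zero (α := ℕ) one_ne_zero]
      refine ENNReal.tsum_le_tsum fun i => ?_
      rw [indicator_of_mem (hall i), ← ENNReal.ofReal_one]
      exact ENNReal.ofReal_le_ofReal
        (Real.one_le_rpow (by exact_mod_cast Nat.le_add_left 1 _) hr0)
    classical
    set i := Nat.find hex
    have hnot : ω ∉ bad n (m₀ + i : ℕ) := fun h => Nat.find_spec hex (subset_toMeasurable _ _ h)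
    have hVi : ENNReal.ofReal (((m₀ + i : ℕ) : ℝ) ^ r) ≤ V ω := by
      rcases Nat.eq_zero_or_pos i with h0 | hpos
      · rw [h0]
        exact le_self_add
      · -- the index before the first good level already contributes `(m₀ + i) ^ r`
        have hmem : ω ∈ H (i - 1) := not_not.1 (Nat.find_min hex (by omega : i - 1 < i))
        refine le_trans ?_ le_add_self
        refine le_trans ?_ (ENNReal.le_tsum (i - 1))
        rw [indicator_of_mem hmem, hw]
        simp only
        rw [show m₀ + (i - 1) + 1 = m₀ + i by omega]
    calc Y n ω ^ r ≤ (2 * X n ω + ENNReal.ofReal ((m₀ + i : ℕ) * ρ n)) ^ r :=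
          ENNReal.rpow_le_rpow (hY n _ ω hnot) hr0
      _ ≤ 2 ^ (r - 1) *
          ((2 * X n ω) ^ r + ENNReal.ofReal ((m₀ + i : ℕ) * ρ n) ^ r) :=
          ENNReal.rpow_add_le_mul_rpow_add_rpow _ _ hr
      _ ≤ _ := by
          gcongr
          rw [ENNReal.ofReal_rpow_of_nonneg (mul_nonneg (by positivity) (hρ n)) hr0,
            Real.mul_rpow (by positivity) (hρ n), mul_comm, ENNReal.ofReal_mul hρr]
          gcongr
  calc ∫⁻ ω, Y n ω ^ r ∂(P n)
      ≤ ∫⁻ ω, 2 ^ (r - 1) * ((2 * X n ω) ^ r + ENNReal.ofReal (ρ n ^ r) * V ω) ∂(P n) :=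
        lintegral_mono_ae hpt
    _ = 2 ^ (r - 1) * (2 ^ r * ∫⁻ ω, X n ω ^ r ∂(P n) +
          ENNReal.ofReal (ρ n ^ r) * ∫⁻ ω, V ω ∂(P n)) := by
        rw [lintegral_const_mul' _ _ (by finiteness),
          lintegral_add_right _ (hVm.const_mul _), lintegral_const_mul _ hVm]
        simp_rw [ENNReal.mul_rpow_of_nonneg _ _ hr0]
        rw [lintegral_const_mul' _ _ (by finiteness)]
    _ ≤ 2 ^ (r - 1) * (2 ^ r * (C * ENNReal.ofReal (ρ n ^ r)) +
          ENNReal.ofReal (ρ n ^ r) * ENNReal.ofReal ((m₀ : ℝ) ^ r + T)) := by gcongr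
    _ = _ := by ring

/-! ### The convergence rates -/

theorem corollary1 {Ω : ℕ → Type*} [∀ n, MeasurableSpace (Ω n)]
    (P : ∀ n, Measure (Ω n)) [∀ n, IsProbabilityMeasure (P n)]
    (a b : ℝ) (hab : a < b)
    (f : ℝ → ℝ) (hf : IsRegularDecreasing f a b)
    (F : ℝ → ℝ) (hF : ∀ t ∈ Icc a b, F t = ∫ x in a..t, f x)
    (L : ℝ → ℝ) (hL : IsRegularIncreasing L a b)
    (Fn : ∀ n, ℝ → Ω n → ℝ)
    (hFn_meas : ∀ n, ∀ t ∈ Icc a b, AEMeasurable (Fn n t) (P n))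
    (hFn_cadlag : ∀ n, ∀ᵐ ω ∂(P n), IsCadlagOn (fun t => Fn n t ω) a b)
    (B : ∀ n, ℝ → Ω n → ℝ)
    (hB : (∀ n, IsBrownianMotionOn (Icc (L a) (L b)) (B n) (P n)) ∨
      ∃ p q : ℝ, ∀ n, IsBrownianBridgeOn p q (Icc (L a) (L b)) (B n) (P n))
    (γ : ℕ → ℝ)
    (hγ : γ =O[atTop] fun n : ℕ => (Real.log n / n) ^ (2 / 3 : ℝ))
    (hembed : IsBigOInProb P
      (fun n ω => supAbs (Icc a b)
        fun t => Fn n t ω - F t - (n : ℝ) ^ (-(1 / 2) : ℝ) * B n (L t) ω) γ) :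
    IsBigOInProb P
      (fun n ω => supAbs (Icc a b)
        fun x => leastConcaveMajorant (Icc a b) (fun t => Fn n t ω) x - Fn n x ω)
      (fun n : ℕ => (Real.log n / n) ^ (2 / 3 : ℝ)) ∧
    (0 ∈ Icc (L a) (L b) → ∀ r : ℝ, 1 ≤ r →
      IsBigOMoment P
        (fun n ω => supAbs (Icc a b)
          fun t => Fn n t ω - F t - (n : ℝ) ^ (-(1 / 2) : ℝ) * B n (L t) ω) r
        (fun n : ℕ => (Real.log n / n) ^ (2 * r / 3)) →
      IsBigOMoment P
        (fun n ω => supAbs (Icc a b)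
          fun x => leastConcaveMajorant (Icc a b) (fun t => Fn n t ω) x - Fn n x ω) r
        (fun n : ℕ => (Real.log n / n) ^ (2 * r / 3))) ∧
    (∃ K₁ K₂ : ℝ, 0 < K₁ ∧ 0 < K₂ ∧ ∀ n,
      OscillationTailBound 1 K₁ K₂ (Icc (L a) (L b)) (B n) (P n) ∧
      ParabolicTailBound 1 K₁ K₂ (Icc (L a) (L b)) (B n) (P n)) := by
  have hinc : ∀ n, HasSubgaussianIncrements (Icc (L a) (L b)) (B n) (P n) := by
    rcases hB with h | ⟨p, q, h⟩
    · exact fun n => (h n).hasSubgaussianIncrements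
    · exact fun n => (h n).hasSubgaussianIncrements
  have hLab : L a ≤ L b := hL.monotoneOn (left_mem_Icc.2 hab.le) (right_mem_Icc.2 hab.le) hab.le
  have hLmem : ∀ t ∈ Icc a b, L t ∈ Icc (L a) (L b) := fun t ht =>
    ⟨hL.monotoneOn (left_mem_Icc.2 hab.le) ht ht.1, hL.monotoneOn ht (right_mem_Icc.2 hab.le) ht.2⟩
  obtain ⟨c, hc, hanti⟩ := hf.exists_antitoneOn_add_mul
  obtain ⟨Λ, hΛ, hLip⟩ := hL.exists_lipschitz
  have hFquad : ∀ x ∈ Icc a b, ∀ t ∈ Icc a b,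
      F t ≤ F x + f x * (t - x) - c / 2 * (t - x) ^ 2 := fun x hx t ht => by
    rw [hF x hx, hF t ht]
    exact integral_le_affine_sub_quadratic hf.contDiffOn.continuousOn hanti hx ht
  -- `κ (L t - L x) ^ 2 ≤ (c / 2) (t - x) ^ 2`
  set κ : ℝ := c / (2 * Λ ^ 2) with hκ
  have hκ0 : 0 < κ := by positivity
  set ρ : ℕ → ℝ := fun n => (Real.log n / n) ^ (2 / 3 : ℝ) with hρ
  have hq : ∀ n : ℕ, 0 ≤ Real.log n / n := fun n =>
    div_nonneg (Real.log_natCast_nonneg n) n.cast_nonneg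
  have hρ0 : ∀ n, 0 ≤ ρ n := fun n => Real.rpow_nonneg (hq n) _
  set bad : ∀ n, ℝ → Set (Ω n) := fun n M => {ω | ∃ x ∈ Icc (L a) (L b), ∃ y ∈ Icc (L a) (L b),
    M * ρ n + κ * (x - y) ^ 2 < (n : ℝ) ^ (-(1 / 2) : ℝ) * |B n x ω - B n y ω|} with hbad_def
  have hbad : ∀ n, 3 ≤ n → ∀ M, max (10 * κ) (1024 / κ) ≤ M → P n (bad n M) ≤
      ENNReal.ofReal ((L b - L a + 1) * (4 * Real.exp 16) * Real.exp (-(κ / 1024 * M))) :=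
    fun n hn M hM => (hinc n).measure_scaled_quadratic_excess_le hLab hκ0
      ((le_max_left _ _).trans hM) ((le_max_right _ _).trans hM) hn
  have hY : ∀ n M ω, ω ∉ bad n M →
      supAbs (Icc a b) (fun x => leastConcaveMajorant (Icc a b) (fun t => Fn n t ω) x - Fn n x ω) ≤
        2 * supAbs (Icc a b) (fun t => Fn n t ω - F t - (n : ℝ) ^ (-(1 / 2) : ℝ) * B n (L t) ω) +
          ENNReal.ofReal (M * ρ n) := by
    intro n M ω hω
    refine supAbs_leastConcaveMajorant_sub_le (convex_Icc a b) hFquad fun x hx t ht => ?_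
    have h1 : (n : ℝ) ^ (-(1 / 2) : ℝ) * |B n (L t) ω - B n (L x) ω| ≤
        M * ρ n + κ * (L t - L x) ^ 2 := by
      by_contra hlt
      exact hω ⟨L t, hLmem t ht, L x, hLmem x hx, not_le.1 hlt⟩
    have h2 : κ * (L t - L x) ^ 2 ≤ c / 2 * (t - x) ^ 2 := by
      calc κ * (L t - L x) ^ 2 = κ * |L t - L x| ^ 2 := by rw [sq_abs]
        _ ≤ κ * (Λ * |t - x|) ^ 2 := by gcongr; exact hLip x hx t ht
        _ = c / 2 * (t - x) ^ 2 := by rw [mul_pow, sq_abs, hκ]; field_simp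
    rw [← mul_sub, abs_mul, abs_of_nonneg (Real.rpow_nonneg n.cast_nonneg _)]
    linarith
  refine ⟨isBigOInProb_of_le_two_mul_add (by positivity) hρ0 hbad hY hγ hembed,
    fun _ r hr hmom => ?_, ?_⟩
  · have hpow : (fun n : ℕ => (Real.log n / n) ^ (2 * r / 3)) = fun n => ρ n ^ r := by
      funext n
      rw [hρ, ← Real.rpow_mul (hq n)]
      ring_nf
    rw [hpow] at hmom ⊢
    have : 0 ≤ L b - L a + 1 := by linarith
    exact isBigOMoment_of_le_two_mul_add (by positivity) (by positivity) hr hρ0 hbad hY hmom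
  · exact ⟨4 * Real.exp 16, 1 / 64, by positivity, by norm_num, fun n =>
      ⟨(hinc n).oscillationTailBound, (hinc n).parabolicTailBound⟩⟩
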